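/- Assume the axiom of choice. Write $\mathsf{Mon}$ for the category of monads on the category of sets. For a monad $R$, let $\mathsf{Mod}(R)$ be the category of $R$-modules: functors $M:\mathsf{Set}\to\mathsf{Set}$ with a natural transformation $\rho^M:M\cdot R\to M$ such that $\rho^M\circ\rho^M R=\rho^M\circ M\mu$ and $\rho^M\circ M\eta=1_M$; morphisms are the natural transformations $\tau$ with $\tau\circ\rho^M=\rho^N\circ\tau R$. Every monad is a module over itself, and an $S$-module $M$ pulls back along a monad morphism $f:R\to S$ to the $R$-module $f^*M$ with the same functor and substitution $\rho^M\circ Mf$. The total category of modules has as objects the pairs $(R,M)$ with $M$ an $R$-module, and as morphisms $(R,M)\to(S,N)$ the pairs of a monad morphism $f:R\to S$ and an $R$-module morphism $M\to f^*N$. A *signature* is a section of the forgetful functor from the total category of modules to $\mathsf{Mon}$; it assigns functorially to each monad $R$ an $R$-module $\Sigma(R)$ and to each $f:R\to S$ a morphism $\Sigma(f):\Sigma(R)\to f^*\Sigma(S)$. A morphism of signatures is a natural transformation lying over the identity of $\mathsf{Mon}$. The derivative $M'$ of an $R$-module $M$ is the functor $X\mapsto M(X+*)$ with substitution $M(RX+*)\to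 M(R(X+*))\to M(X+*)$, where the first map is $M[R(i_X),\eta_{X+*}\circ\underline{*}]$ (with $i_X:X\to X+*$ and $\underline{*}:*\to X+*$ the coproduct inclusions) and the second is $\rho^M_{X+*}$; $M^{(k)}$ is the $k$-th iterated derivative. An *elementary* signature is one of the form $R\mapsto R^{(s_1)}\times\cdots\times R^{(s_n)}$ for a finite (possibly empty) sequence $(s_1,\dots,s_n)$ of nonnegative integers, and an *algebraic* signature is a coproduct, in the category of signatures, of a (possibly infinite) set-indexed family of elementary signatures. A *presentation* of a signature $\Sigma$ is a morphism of signatures $p:\Upsilon\to\Sigma$ with $\Upsilon$ algebraic and $p$ an epimorphism in the category of signatures. A *model* of $\Sigma$ is a pair $(R,r)$ of a monad $R$ and a morphism of $R$-modules $r:\Sigma(R)\to R$; a morphism $(R,r)\to(S,s)$ of models is a monad morphism $m:R\to S$ with $m\circ r=s\circ\Sigma(m)$. These form a category $\mathsf{Mon}^\Sigma$. A morphism of signatures $p:\Upsilon\to\Sigma$ induces the functor $p^*:\mathsf{Mon}^\Sigma\to\mathsf{Mon}^\Upsilon$, $(R,r)\mapsto(R,r\circ p(R))$, which is the identity on underlying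 monad morphisms. **Theorem.** Let $\Sigma$ be a signature and let $p:\Upsilon\to\Sigma$ be a presentation of $\Sigma$. Then the functor $p^*:\mathsf{Mon}^\Sigma\to\mathsf{Mon}^\Upsilon$ has a left adjoint. -/

import Mathlib

open CategoryTheory

universe u

namespace MonadSyntax

/-- A (left) module over a monad `R` on the category of sets: a functor `M : Set ⥤ Set` with a
natural transformation `ρ : M ∘ R ⟶ M` (the module substitution) such that
`ρ ∘ ρ R = ρ ∘ M μ` and `ρ ∘ M η = 1`. In diagrammatic order `M ∘ R` is `R ⋙ M`. -/
structure LMod (R : Monad (Type u)) where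
  /-- The underlying endofunctor. -/
  functor : Type u ⥤ Type u
  /-- The module substitution. -/
  subst : R.toFunctor ⋙ functor ⟶ functor
  subst_subst : ∀ X : Type u,
    subst.app (R.obj X) ≫ subst.app X = functor.map (R.μ.app X) ≫ subst.app X
  map_unit_subst : ∀ X : Type u, functor.map (R.η.app X) ≫ subst.app X = 𝟙 (functor.obj X)

namespace LMod

/-- Morphisms of `R`-modules: linear natural transformations, `τ ∘ ρ^M = ρ^N ∘ τ R`. -/
@[ext]
structure Hom {R : Monad (Type u)} (M N : LMod R) where
  /-- The underlying natural transformation. -/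
  nat : M.functor ⟶ N.functor
  linear : ∀ X : Type u, M.subst.app X ≫ nat.app X = nat.app (R.obj X) ≫ N.subst.app X

/-- The category `Mod(R)` of modules over a fixed monad `R`. -/
instance (R : Monad (Type u)) : Category (LMod R) where
  Hom M N := Hom M N
  id M := { nat := 𝟙 M.functor, linear := fun X => by simp }
  comp f g :=
    { nat := f.nat ≫ g.nat
      linear := fun X => by
        rw [NatTrans.comp_app, NatTrans.comp_app, ← Category.assoc, f.linear, Category.assoc,
          g.linear, Category.assoc] }
  id_comp f := Hom.ext (Category.id_comp f.nat)
  comp_id f := Hom.ext (Category.comp_id f.nat)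
  assoc f g h := Hom.ext (Category.assoc f.nat g.nat h.nat)

/-- Every monad is a module over itself: the tautological module. -/
@[reducible]
def taut (R : Monad (Type u)) : LMod R where
  functor := R.toFunctor
  subst := R.μ
  subst_subst X := (R.assoc X).symm
  map_unit_subst X := R.right_unit X

/-- The pullback `f^* M` of an `S`-module `M` along a monad morphism `f : R ⟶ S`: the same functor
with the substitution `M ∘ R ⟶ M ∘ S ⟶ M`. -/
@[reducible]
def pullback {R S : Monad (Type u)} (f : R ⟶ S) (M : LMod S) : LMod R where
  functor := M.functor
  subst := Functor.whiskerRight f.toNatTrans M.functor ≫ M.subst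
  subst_subst X := by
    have h1 := M.subst.naturality (f.app X)
    have h2 := M.subst_subst X
    have h3 := f.app_μ X
    simp only [Functor.comp_map] at h1
    simp only [NatTrans.comp_app, Functor.whiskerRight_app, Category.assoc]
    rw [← reassoc_of% h1, h2, ← M.functor.map_comp_assoc, ← M.functor.map_comp_assoc,
      ← M.functor.map_comp_assoc]
    congr 2
    rw [h3, f.naturality]
  map_unit_subst X := by
    simp only [NatTrans.comp_app, Functor.whiskerRight_app]
    rw [← M.functor.map_comp_assoc, f.app_η, M.map_unit_subst]

/-- The functor `X ↦ X + *`. -/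
@[reducible]
def addPoint : Type u ⥤ Type u where
  obj X := X ⊕ PUnit.{u + 1}
  map g := TypeCat.ofHom (Sum.map (fun x => g x) id)
  map_id X := by ext x; cases x <;> rfl
  map_comp f g := by ext x; cases x <;> rfl

/-- The inclusion `i_X : X → X + *`. -/
abbrev incl (X : Type u) : X ⟶ addPoint.obj X := TypeCat.ofHom (fun x => Sum.inl x)

/-- The map `[R(i_X), η_{X+*} ∘ *] : R X + * ⟶ R (X + *)`. -/
def swapPoint (R : Monad (Type u)) : R.toFunctor ⋙ addPoint ⟶ addPoint ⋙ R.toFunctor where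
  app X := TypeCat.ofHom (Sum.elim (fun x => R.map (incl X) x)
    (fun _ => R.η.app (X ⊕ PUnit.{u + 1}) (Sum.inr PUnit.unit : X ⊕ PUnit.{u + 1})))
  naturality X Y g := by
    ext x
    cases x with
    | inl x =>
      change R.map (incl Y) (R.map g x) = R.map (addPoint.map g) (R.map (incl X) x)
      rw [← Functor.map_comp_apply, ← Functor.map_comp_apply]
      rfl
    | inr x =>
      exact NatTrans.naturality_apply R.η (addPoint.map g) (Sum.inr PUnit.unit : X ⊕ PUnit)

theorem swapPoint_unit (R : Monad (Type u)) (X : Type u) :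
    addPoint.map (R.η.app X) ≫ (swapPoint R).app X = R.η.app (addPoint.obj X) := by
  ext x
  cases x with
  | inl x => exact (NatTrans.naturality_apply R.η (incl X) x).symm
  | inr x => rfl

theorem swapPoint_mul (R : Monad (Type u)) (X : Type u) :
    (swapPoint R).app (R.obj X) ≫ R.map ((swapPoint R).app X) ≫ R.μ.app (addPoint.obj X) =
      addPoint.map (R.μ.app X) ≫ (swapPoint R).app X := by
  ext x
  cases x with
  | inl x =>
    change R.μ.app _ (R.map ((swapPoint R).app X) (R.map (incl (R.obj X)) x)) =
      R.map (incl X) (R.μ.app X x)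
    rw [← Functor.map_comp_apply]
    exact NatTrans.naturality_apply R.μ (incl X) x
  | inr x =>
    change R.μ.app _ (R.map ((swapPoint R).app X)
      (R.η.app (R.obj X ⊕ PUnit.{u + 1})
      (Sum.inr PUnit.unit : R.obj X ⊕ PUnit.{u + 1}))) =
        R.η.app (X ⊕ PUnit.{u + 1}) (Sum.inr PUnit.unit : X ⊕ PUnit.{u + 1})
    have h := NatTrans.naturality_apply R.η ((swapPoint R).app X)
      (Sum.inr PUnit.unit : R.obj X ⊕ PUnit)
    refine (congrArg (fun t => R.μ.app _ t) h.symm).trans ?_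
    exact ConcreteCategory.congr_hom (R.left_unit (addPoint.obj X))
      (R.η.app (X ⊕ PUnit.{u + 1}) (Sum.inr PUnit.unit : X ⊕ PUnit.{u + 1}))

theorem swapPoint_hom {R S : Monad (Type u)} (f : R ⟶ S) (X : Type u) :
    (swapPoint R).app X ≫ f.app (addPoint.obj X) =
      addPoint.map (f.app X) ≫ (swapPoint S).app X := by
  ext x
  cases x with
  | inl x => exact NatTrans.naturality_apply f.toNatTrans (incl X) x
  | inr x =>
    exact ConcreteCategory.congr_hom (f.app_η (X ⊕ PUnit.{u + 1}))
      (Sum.inr PUnit.unit : X ⊕ PUnit.{u + 1})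

/-- The derivative `M'` of a module `M`: the functor `X ↦ M (X + *)`, with the substitution
`M (R X + *) ⟶ M (R (X + *)) ⟶ M (X + *)`. -/
@[reducible]
def deriv {R : Monad (Type u)} (M : LMod R) : LMod R where
  functor := addPoint ⋙ M.functor
  subst := Functor.whiskerRight (swapPoint R) M.functor ≫ Functor.whiskerLeft addPoint M.subst
  subst_subst X := by
    have h1 := M.subst.naturality ((swapPoint R).app X)
    have h2 := M.subst_subst (addPoint.obj X)
    have h3 := swapPoint_mul R X
    simp only [Functor.comp_map] at h1
    simp only [NatTrans.comp_app, Functor.whiskerRight_app, Functor.whiskerLeft_app,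
      Functor.comp_map, Category.assoc]
    rw [← reassoc_of% h1, h2, ← M.functor.map_comp_assoc, ← M.functor.map_comp_assoc,
      ← M.functor.map_comp_assoc]
    congr 2
  map_unit_subst X := by
    simp only [NatTrans.comp_app, Functor.whiskerRight_app, Functor.whiskerLeft_app,
      Functor.comp_map]
    rw [← M.functor.map_comp_assoc, swapPoint_unit, M.map_unit_subst]

/-- The (pointwise) product of a family of `R`-modules; the empty product is the final module. -/
@[reducible]
def pi {R : Monad (Type u)} {ι : Type} (M : ι → LMod R) : LMod R where
  functor :=
    { obj := fun X => ∀ i, (M i).functor.obj X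
      map := fun g => TypeCat.ofHom (fun x i => (M i).functor.map g (x i))
      map_id := fun X => by ext x i; exact Functor.map_id_apply (M i).functor X (x i)
      map_comp := fun f g => by
        ext x i; exact Functor.map_comp_apply (M i).functor f g (x i) }
  subst :=
    { app := fun X => TypeCat.ofHom (fun x i => (M i).subst.app X (x i))
      naturality := fun X Y g => by
        ext x i; exact NatTrans.naturality_apply (M i).subst g (x i) }
  subst_subst X := by
    ext x i; exact ConcreteCategory.congr_hom ((M i).subst_subst X) (x i)
  map_unit_subst X := by
    ext x i; exact ConcreteCategory.congr_hom ((M i).map_unit_subst X) (x i)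

end LMod

/-- A signature: a section of the forgetful functor from the total category of modules over
monads to the category of monads. Explicitly, it assigns to every monad `R` an `R`-module and to
every monad morphism `f : R ⟶ S` an `R`-linear morphism `Σ(f) : Σ(R) ⟶ f^* Σ(S)` (i.e. a morphism
`(R, Σ(R)) ⟶ (S, Σ(S))` of the total category lying over `f`), functorially. -/
structure Signature where
  /-- The module assigned to a monad. -/
  obj : ∀ R : Monad (Type u), LMod R
  /-- The module morphism assigned to a monad morphism. -/
  map : ∀ {R S : Monad (Type u)} (f : R ⟶ S), obj R ⟶ (obj S).pullback f
  map_id : ∀ R : Monad (Type u), (map (𝟙 R)).nat = 𝟙 (obj R).functor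
  map_comp : ∀ {R S T : Monad (Type u)} (f : R ⟶ S) (g : S ⟶ T) (X : Type u),
    (map (f ≫ g)).nat.app X = (map f).nat.app X ≫ (map g).nat.app X

namespace Signature

/-- Morphisms of signatures: natural transformations between the corresponding functors from
monads to the total category of modules that lie over the identity. -/
@[ext]
structure Hom (S T : Signature.{u}) where
  /-- The component at a monad, a module morphism. -/
  app : ∀ R : Monad (Type u), S.obj R ⟶ T.obj R
  naturality : ∀ {R R' : Monad (Type u)} (f : R ⟶ R') (X : Type u),
    (S.map f).nat.app X ≫ (app R').nat.app X = (app R).nat.app X ≫ (T.map f).nat.app X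

/-- The category of signatures. -/
instance : Category Signature.{u} where
  Hom S T := Hom S T
  id S :=
    { app := fun R => 𝟙 (S.obj R)
      naturality := fun f X => (Category.comp_id _).trans (Category.id_comp _).symm }
  comp a b :=
    { app := fun R => a.app R ≫ b.app R
      naturality := fun {R R'} f X => by
        change _ ≫ (a.app R').nat.app X ≫ (b.app R').nat.app X =
          ((a.app R).nat.app X ≫ (b.app R).nat.app X) ≫ _
        rw [← Category.assoc, a.naturality, Category.assoc, b.naturality, Category.assoc] }
  id_comp a := Hom.ext (funext fun R => Category.id_comp (a.app R))
  comp_id a := Hom.ext (funext fun R => Category.comp_id (a.app R))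
  assoc a b c := Hom.ext (funext fun R => Category.assoc (a.app R) (b.app R) (c.app R))

/-- The signature `Θ`, given by `R ↦ R` (the tautological module). -/
@[reducible]
def theta : Signature.{u} where
  obj R := LMod.taut R
  map {R S} f :=
    { nat := f.toNatTrans
      linear := fun X => by
        have h := f.app_μ X
        rw [f.naturality] at h
        exact h.trans (Category.assoc _ _ _) }
  map_id R := rfl
  map_comp f g X := rfl

/-- The derivative of a signature, `R ↦ Σ(R)'`. -/
@[reducible]
def deriv (S : Signature.{u}) : Signature.{u} where
  obj R := (S.obj R).deriv
  map {R T} f :=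
    { nat := Functor.whiskerLeft LMod.addPoint (S.map f).nat
      linear := fun X => by
        have h1 := (S.map f).linear (LMod.addPoint.obj X)
        have h2 := (S.map f).nat.naturality ((LMod.swapPoint R).app X)
        have h3 := LMod.swapPoint_hom f X
        change ((S.obj R).functor.map ((LMod.swapPoint R).app X) ≫
          (S.obj R).subst.app (LMod.addPoint.obj X)) ≫
            (S.map f).nat.app (LMod.addPoint.obj X) =
          (S.map f).nat.app (LMod.addPoint.obj (R.obj X)) ≫
            (S.obj T).functor.map (LMod.addPoint.map (f.app X)) ≫
              (S.obj T).functor.map ((LMod.swapPoint T).app X) ≫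
                (S.obj T).subst.app (LMod.addPoint.obj X)
        change _ = (S.map f).nat.app (R.obj (LMod.addPoint.obj X)) ≫
          (S.obj T).functor.map (f.app (LMod.addPoint.obj X)) ≫
            (S.obj T).subst.app (LMod.addPoint.obj X) at h1
        change (S.obj R).functor.map ((LMod.swapPoint R).app X) ≫
            (S.map f).nat.app (R.obj (LMod.addPoint.obj X)) =
          (S.map f).nat.app (LMod.addPoint.obj (R.obj X)) ≫
            (S.obj T).functor.map ((LMod.swapPoint R).app X) at h2
        rw [Category.assoc, h1, reassoc_of% h2, ← Functor.map_comp_assoc, h3,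
          Functor.map_comp_assoc] }
  map_id R := by
    ext1
    funext X
    exact NatTrans.congr_app (S.map_id R) (LMod.addPoint.obj X)
  map_comp f g X := S.map_comp f g (LMod.addPoint.obj X)

/-- The (pointwise) product of a family of signatures. -/
@[reducible]
def pi {ι : Type} (S : ι → Signature.{u}) : Signature.{u} where
  obj R := LMod.pi fun i => (S i).obj R
  map {R T} f :=
    { nat :=
        { app := fun X => TypeCat.ofHom (fun x i => ((S i).map f).nat.app X (x i))
          naturality := fun X Y g => by
            ext x i; exact NatTrans.naturality_apply ((S i).map f).nat g (x i) }
      linear := fun X => by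
        ext x i; exact ConcreteCategory.congr_hom (((S i).map f).linear X) (x i) }
  map_id R := by
    ext X x i
    exact ConcreteCategory.congr_hom (NatTrans.congr_app ((S i).map_id R) X) (x i)
  map_comp f g X := by
    ext x i; exact ConcreteCategory.congr_hom ((S i).map_comp f g X) (x i)

/-- The elementary signature `Θ^(s) : R ↦ R^(s_1) × ⋯ × R^(s_n)` of a finite sequence `s` of
nonnegative integers, where `R^(k)` is the `k`-th derivative of the tautological module. -/
def elementary (s : List ℕ) : Signature.{u} :=
  pi fun j : Fin s.length => deriv^[s.get j] theta

/-- A signature is algebraic if it is a coproduct, in the category of signatures, of a (possibly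
infinite) set-indexed family of elementary signatures. -/
def IsAlgebraic (S : Signature.{u}) : Prop :=
  ∃ (I : Type u) (s : I → List ℕ) (ι : ∀ i, elementary.{u} (s i) ⟶ S),
    Nonempty (Limits.IsColimit (Limits.Cofan.mk S ι))

/-- A morphism of signatures `p : Υ ⟶ S` is a presentation of `S` if `Υ` is algebraic and `p` is
an epimorphism in the category of signatures. -/
structure IsPresentation {Υ S : Signature.{u}} (p : Υ ⟶ S) : Prop where
  isAlgebraic : Υ.IsAlgebraic
  epi : Epi p

end Signature

/-- A model of a signature `S`: a monad `R` with an action of `S` in `R`, that is, a morphism of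
`R`-modules from `S(R)` to the tautological module `R`. -/
structure Model (S : Signature.{u}) where
  /-- The underlying monad. -/
  monad : Monad (Type u)
  /-- The action. -/
  action : S.obj monad ⟶ LMod.taut monad

namespace Model

/-- Morphisms of models: monad morphisms `m` with `m ∘ r = s ∘ S(m)`. -/
@[ext]
structure Hom {S : Signature.{u}} (A B : Model S) where
  /-- The underlying monad morphism. -/
  hom : A.monad ⟶ B.monad
  comm : ∀ X : Type u,
    A.action.nat.app X ≫ hom.app X = (S.map hom).nat.app X ≫ B.action.nat.app X

/-- The category of models of a signature. -/
instance (S : Signature.{u}) : Category (Model S) where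
  Hom A B := Hom A B
  id A :=
    { hom := 𝟙 A.monad
      comm := fun X => by
        rw [S.map_id]
        exact (Category.comp_id _).trans (Category.id_comp _).symm }
  comp {A B C} f g :=
    { hom := f.hom ≫ g.hom
      comm := fun X => by
        rw [S.map_comp, Category.assoc, ← g.comm, ← Category.assoc, ← f.comm, Category.assoc]
        rfl }
  id_comp f := Hom.ext (Category.id_comp f.hom)
  comp_id f := Hom.ext (Category.comp_id f.hom)
  assoc f g h := Hom.ext (Category.assoc f.hom g.hom h.hom)

/-- The functor `p^*` from models of `S` to models of `Υ` induced by a morphism of signatures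
`p : Υ ⟶ S`: it sends `(R, r)` to `(R, r ∘ p(R))` and is the identity on underlying monad
morphisms. -/
def pullback {Υ S : Signature.{u}} (p : Υ ⟶ S) : Model S ⥤ Model Υ where
  obj A := { monad := A.monad, action := p.app A.monad ≫ A.action }
  map {A B} f :=
    { hom := f.hom
      comm := fun X => by
        change ((p.app A.monad).nat.app X ≫ A.action.nat.app X) ≫ f.hom.app X =
          (Υ.map f.hom).nat.app X ≫ (p.app B.monad).nat.app X ≫ B.action.nat.app X
        rw [Category.assoc, f.comm, ← Category.assoc, ← p.naturality, Category.assoc] }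
  map_id A := rfl
  map_comp f g := rfl

end Model

end MonadSyntax

/-! A left adjoint of `p^*` is obtained by forcing a model of `Υ` to become a model of `S`. Given a
model `A` of `Υ` with monad `R`, identify two elements of `R X` when every morphism from `A` to some
`p^* B` sends them to the same element. The quotient `R̄` is a monad: by choice the projection `π`
is pointwise split, so functors keep it epi, and the multiplication descends because each member of
the family respects it (`map_coimageProj_mul`).

The action on `R̄` comes from descending `Υ(R) ⟶ R ⟶ R̄` along `Υ(R) ⟶ S(R) ⟶ S(R̄)`. This needs two
facts. The latter map is surjective: by naturality it is also `Υ(R) ⟶ Υ(R̄) ⟶ S(R̄)`, where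
algebraic signatures preserve surjections (`IsAlgebraic.preservesSurjective`) and epimorphisms of
signatures are pointwise surjective (`epi_app_of_epi`). And it identifies only elements with equal
images in `R̄`: each test morphism out of `A`, applied after the action, factors through `S(R̄)`
(`reflectionModuleProj_desc`).

By construction every morphism from `A` to a `p^* B` factors through `R̄`, uniquely since `π` is
epi. Hence the unit is initial in its comma category. -/

namespace MonadSyntax

/-! ### Quotients of a monad along a pointwise split epimorphism. -/

section QuotientMonad

universe v w

variable {C : Type w} [Category.{v} C] (R : Monad C) (Q : C ⥤ C) (π : R.toFunctor ⟶ Q)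
  [∀ X, IsSplitEpi (π.app X)]
  (m : ∀ X, Q.obj (Q.obj X) ⟶ Q.obj X)
  (hm : ∀ X, R.map (π.app X) ≫ π.app (Q.obj X) ≫ m X = R.μ.app X ≫ π.app X)

/-- The monad structure on a pointwise split quotient `π : R ⟶ Q` of a monad `R` along which the
multiplication descends. -/
@[reducible]
def quotientMonad : Monad C where
  toFunctor := Q
  η := R.η ≫ π
  μ :=
    { app := m
      naturality := fun X Y g => by
        change Q.map (Q.map g) ≫ m Y = m X ≫ Q.map g
        -- `π` is split, so `R.map` of it is still epi. The law can be tested on `R R X`, where `hm`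
        -- turns `m` into `μ`.
        rw [← cancel_epi (π.app (Q.obj X)), ← cancel_epi (R.map (π.app X))]
        have h1 := reassoc_of% hm X
        rw [h1, ← π.naturality g, ← π.naturality_assoc (Q.map g), ← R.map_comp_assoc,
          ← π.naturality g, R.map_comp_assoc, hm, R.mu_naturality_assoc] }
  assoc X := by
    change Q.map (m X) ≫ m X = m (Q.obj X) ≫ m X
    -- Three layers of `Q` are lifted to `R R R X`, where associativity of `R` applies.
    rw [← cancel_epi (π.app (Q.obj (Q.obj X))), ← cancel_epi (R.map (π.app (Q.obj X))),
      ← cancel_epi (R.map (R.map (π.app X)))]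
    have h1 := reassoc_of% hm (Q.obj X)
    rw [h1, ← π.naturality_assoc (m X), ← R.map_comp_assoc, ← R.map_comp_assoc,
      Category.assoc, hm, R.map_comp_assoc, hm, R.mu_naturality_assoc, hm, reassoc_of% R.assoc]
  left_unit X := by
    change (R.η.app (Q.obj X) ≫ π.app (Q.obj X)) ≫ m X = 𝟙 (Q.obj X)
    rw [← cancel_epi (π.app X), Category.assoc, R.unit_naturality_assoc, hm, R.left_unit_assoc]
    exact (Category.comp_id _).symm
  right_unit X := by
    change Q.map (R.η.app X ≫ π.app X) ≫ m X = 𝟙 (Q.obj X)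
    rw [← cancel_epi (π.app X), ← π.naturality_assoc, R.map_comp_assoc, hm, R.right_unit_assoc]
    exact (Category.comp_id _).symm

/-- The projection onto the quotient monad. -/
@[reducible]
def quotientMonad.proj : R ⟶ quotientMonad R Q π m hm where
  toNatTrans := π
  app_η _ := rfl
  app_μ X := by
    rw [Category.assoc]
    exact (hm X).symm

variable {R Q π m hm}

/-- A monad morphism out of `R` that factors pointwise through the quotient monad factors through
it. -/
@[reducible]
def quotientMonad.desc {T : Monad C} (j : R ⟶ T) (k : ∀ X, Q.obj X ⟶ T.obj X)
    (hk : ∀ X, π.app X ≫ k X = j.app X) : quotientMonad R Q π m hm ⟶ T where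
  app := k
  naturality X Y g := by
    change Q.map g ≫ k Y = k X ≫ T.map g
    rw [← cancel_epi (π.app X), ← π.naturality_assoc, hk, reassoc_of% hk]
    exact j.naturality g
  app_η X := by
    change (R.η.app X ≫ π.app X) ≫ k X = _
    rw [Category.assoc, hk, j.app_η]
  app_μ X := by
    change m X ≫ k X = (Q.map (k X) ≫ k (T.obj X)) ≫ T.μ.app X
    rw [← cancel_epi (π.app (Q.obj X)), ← cancel_epi (R.map (π.app X)), reassoc_of% hm, hk,
      Category.assoc, ← π.naturality_assoc, ← R.map_comp_assoc, hk, reassoc_of% hk, j.app_μ,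
      Category.assoc]

end QuotientMonad

/-! ### The joint coimage of a possibly large family of monad morphisms. -/

section JointKernel

variable {R : Monad (Type u)} {ι : Sort*} {T : ι → Monad (Type u)} (j : ∀ i, R ⟶ T i)

/-- The elements of `R X` identified by all members of a family of monad morphisms out of `R`. -/
@[reducible]
def jointKernel (X : Type u) : Setoid (R.obj X) where
  r x y := ∀ i, (j i).app X x = (j i).app X y
  iseqv := ⟨fun _ _ => rfl, fun h i => (h i).symm, fun h h' i => (h i).trans (h' i)⟩

/-- The pointwise quotient of a monad by the joint kernel of a family of monad morphisms. -/
@[reducible]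
def coimageFunctor : Type u ⥤ Type u where
  obj X := Quotient (jointKernel j X)
  map {X Y} g := TypeCat.ofHom (Quotient.map (R.map g) fun x y h i => by
    rw [NatTrans.naturality_apply (j i).toNatTrans, NatTrans.naturality_apply (j i).toNatTrans,
      h i])
  map_id X := by
    ext x
    induction x using Quotient.inductionOn with | _ x
    exact congrArg (Quotient.mk _) (Functor.map_id_apply R.toFunctor X x)
  map_comp f g := by
    ext x
    induction x using Quotient.inductionOn with | _ x
    exact congrArg (Quotient.mk _) (Functor.map_comp_apply R.toFunctor f g x)

/-- The projection of a monad onto its quotient by a joint kernel. -/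
@[reducible]
def coimageProj : R.toFunctor ⟶ coimageFunctor j where
  app X := TypeCat.ofHom (Quotient.mk _)

/-- The axiom of choice supplies the section, so any functor keeps the projection epi. -/
instance (X : Type u) : IsSplitEpi ((coimageProj j).app X) :=
  (isSplitEpi_iff_surjective _).2 Quotient.mk_surjective

/-- The factorization of a member of a family of monad morphisms through the joint coimage. -/
def coimageDesc (i : ι) (X : Type u) : (coimageFunctor j).obj X ⟶ (T i).obj X :=
  TypeCat.ofHom (Quotient.lift ((j i).app X) fun _ _ h => h i)

theorem coimageProj_desc (i : ι) (X : Type u) :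
    (coimageProj j).app X ≫ coimageDesc j i X = (j i).app X := rfl

/-- The multiplication on the joint coimage. -/
noncomputable def coimageMul (X : Type u) :
    (coimageFunctor j).obj ((coimageFunctor j).obj X) ⟶ (coimageFunctor j).obj X :=
  TypeCat.ofHom (Quotient.lift
    (fun t => (R.map (section_ ((coimageProj j).app X)) ≫ R.μ.app X ≫ (coimageProj j).app X) t)
    fun s t h => Quotient.sound fun i => by
      -- Since `j i` is natural and multiplicative, the image under `j i` depends on `t` only
      -- through `j i t`. This makes the multiplication well defined on classes.
      have key (t) : (j i).app X (R.μ.app X (R.map (section_ ((coimageProj j).app X)) t)) =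
          ((T i).map (section_ ((coimageProj j).app X) ≫ (j i).app X) ≫ (T i).μ.app X)
            ((j i).app _ t) := by
        have := ConcreteCategory.congr_hom ((j i).app_μ X)
          (R.map (section_ ((coimageProj j).app X)) t)
        refine this.trans ?_
        change ((R.map (section_ ((coimageProj j).app X)) ≫ R.map ((j i).app X) ≫
          (j i).app _) ≫ (T i).μ.app X) t = (((j i).app _ ≫ _) ≫ (T i).μ.app X) t
        rw [← R.map_comp_assoc, (j i).naturality]
      exact (key s).trans ((congrArg _ (h i)).trans (key t).symm))

/-- The section used to define the multiplication is immaterial: equality in the quotient is tested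
by the `j i`, and these do not distinguish an element from the chosen representative of its class.
-/
theorem map_coimageProj_mul (X : Type u) :
    R.map ((coimageProj j).app X) ≫ (coimageProj j).app _ ≫ coimageMul j X =
      R.μ.app X ≫ (coimageProj j).app X := by
  ext w
  refine Quotient.sound fun i => ?_
  have h : (coimageProj j).app X ≫ section_ ((coimageProj j).app X) ≫ (j i).app X =
      (j i).app X := by
    rw [← coimageProj_desc, IsSplitEpi.id_assoc]
  change (R.map ((coimageProj j).app X) ≫ R.map (section_ ((coimageProj j).app X)) ≫
    R.μ.app X ≫ (j i).app X) w = (R.μ.app X ≫ (j i).app X) w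
  rw [(j i).app_μ, Category.assoc, ← R.map_comp_assoc, ← R.map_comp_assoc, Category.assoc, h]

/-- The joint coimage of a family of monad morphisms out of `R`, a quotient monad of `R`. -/
@[reducible]
noncomputable def coimage : Monad (Type u) :=
  quotientMonad R (coimageFunctor j) (coimageProj j) (coimageMul j) (map_coimageProj_mul j)

end JointKernel

/-! ### Descent of module morphisms, and coproducts of modules. -/

namespace LMod

/-- A module morphism over a quotient of monads descends along a surjective module morphism as soon
as it identifies the elements that the latter identifies. -/
theorem exists_desc {R Q : Monad (Type u)} (π : R ⟶ Q) [∀ X, IsSplitEpi (π.app X)]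
    {M : LMod R} {N P : LMod Q} (e : M ⟶ N.pullback π) (he : ∀ X, Epi (e.nat.app X))
    (g : M ⟶ P.pullback π)
    (h : ∀ (X : Type u) (x y : M.functor.obj X), e.nat.app X x = e.nat.app X y →
      g.nat.app X x = g.nat.app X y) :
    ∃ a : N ⟶ P, ∀ X, e.nat.app X ≫ a.nat.app X = g.nat.app X := by
  -- An arbitrary preimage under `e` is chosen; by `h` the value does not depend on it.
  let a (X : Type u) : N.functor.obj X ⟶ P.functor.obj X :=
    TypeCat.ofHom fun x => g.nat.app X (Function.surjInv ((epi_iff_surjective _).1 (he X)) x)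
  have ha (X : Type u) : e.nat.app X ≫ a X = g.nat.app X := by
    ext x
    exact h X _ _ (Function.surjInv_eq ((epi_iff_surjective _).1 (he X)) _)
  refine ⟨{ nat := { app := a, naturality := fun X Y k => ?_ }, linear := fun X => ?_ }, ha⟩
  · have h1 := e.nat.naturality k
    have h2 := g.nat.naturality k
    dsimp only [LMod.pullback] at h1 h2
    rw [← cancel_epi (e.nat.app X), ← reassoc_of% h1, ha, h2, reassoc_of% ha]
  · have h1 := e.linear X
    have h2 := g.linear X
    have h3 := e.nat.naturality (π.app X)
    have h4 := g.nat.naturality (π.app X)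
    dsimp only [LMod.pullback, NatTrans.comp_app, Functor.whiskerRight_app] at h1 h2 h3 h4
    change N.subst.app X ≫ a X = a (Q.obj X) ≫ P.subst.app X
    have := he (Q.obj X)
    -- Linearity over `Q` is tested on `M (R X)`, where it becomes the linearity of `e` and `g` over
    -- `R`. `M` preserves the split epi `π`.
    rw [← cancel_epi (e.nat.app (Q.obj X)), ← cancel_epi (M.functor.map (π.app X)),
      reassoc_of% h3, reassoc_of% ha, ← reassoc_of% h1, ha, h2, reassoc_of% h4]

end LMod

/-- The pointwise coproduct of a family of modules. -/
@[reducible]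
def LMod.sigma {R : Monad (Type u)} {I : Type u} (M : I → LMod R) : LMod R where
  functor :=
    { obj := fun X => Σ i, (M i).functor.obj X
      map := fun g => TypeCat.ofHom (Sigma.map id fun i => (M i).functor.map g)
      map_id := fun X => by
        refine ConcreteCategory.hom_ext _ _ fun ⟨i, x⟩ => ?_
        exact congrArg (Sigma.mk (β := fun i => (M i).functor.obj _) i)
          (Functor.map_id_apply (M i).functor X x)
      map_comp := fun f g => by
        refine ConcreteCategory.hom_ext _ _ fun ⟨i, x⟩ => ?_
        exact congrArg (Sigma.mk (β := fun i => (M i).functor.obj _) i)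
          (Functor.map_comp_apply (M i).functor f g x) }
  subst :=
    { app := fun X => TypeCat.ofHom (Sigma.map id fun i => (M i).subst.app X)
      naturality := fun X Y g => by
        refine ConcreteCategory.hom_ext _ _ fun ⟨i, x⟩ => ?_
        exact congrArg (Sigma.mk (β := fun i => (M i).functor.obj _) i)
          (NatTrans.naturality_apply (M i).subst g x) }
  subst_subst X := by
    refine ConcreteCategory.hom_ext _ _ fun ⟨i, x⟩ => ?_
    exact congrArg (Sigma.mk (β := fun i => (M i).functor.obj _) i)
      (ConcreteCategory.congr_hom ((M i).subst_subst X) x)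
  map_unit_subst X := by
    refine ConcreteCategory.hom_ext _ _ fun ⟨i, x⟩ => ?_
    exact congrArg (Sigma.mk (β := fun i => (M i).functor.obj _) i)
      (ConcreteCategory.congr_hom ((M i).map_unit_subst X) x)

namespace Signature

/-! ### Epimorphisms of signatures are pointwise surjective. -/

section CokernelPair

variable {S T : Signature.{u}} (p : S ⟶ T)

/-- The relation generating the cokernel pair of a morphism of signatures: both copies of an element
of its image are identified. -/
inductive CokernelRel (R : Monad (Type u)) (X : Type u) :
    (T.obj R).functor.obj X ⊕ (T.obj R).functor.obj X →
      (T.obj R).functor.obj X ⊕ (T.obj R).functor.obj X → Prop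
  | glue (y : (S.obj R).functor.obj X) :
      CokernelRel R X (Sum.inl ((p.app R).nat.app X y)) (Sum.inr ((p.app R).nat.app X y))

/-- The map induced between cokernel pairs by a map that preserves the image of `p`. -/
def cokernelMap {R R' : Monad (Type u)} {X Y : Type u}
    (g : (T.obj R).functor.obj X ⟶ (T.obj R').functor.obj Y)
    (h : ∀ y, ∃ z, (p.app R').nat.app Y z = g ((p.app R).nat.app X y)) :
    Quot (CokernelRel p R X) ⟶ Quot (CokernelRel p R' Y) :=
  TypeCat.ofHom (Quot.map (Sum.map g g) (by
    rintro _ _ ⟨y⟩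
    obtain ⟨z, hz⟩ := h y
    simp only [Sum.map_inl, Sum.map_inr, ← hz]
    exact .glue _))

theorem exists_of_comp_eq {R R' : Monad (Type u)} {X Y : Type u}
    {g : (T.obj R).functor.obj X ⟶ (T.obj R').functor.obj Y}
    {g' : (S.obj R).functor.obj X ⟶ (S.obj R').functor.obj Y}
    (h : g' ≫ (p.app R').nat.app Y = (p.app R).nat.app X ≫ g) (y : (S.obj R).functor.obj X) :
    ∃ z, (p.app R').nat.app Y z = g ((p.app R).nat.app X y) :=
  ⟨g' y, ConcreteCategory.congr_hom h y⟩

variable {p}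

/-- Maps between cokernel pairs that are induced by equal maps are equal. -/
theorem cokernelHom_eq {R R' : Monad (Type u)} {X Y : Type u}
    {f g : Quot (CokernelRel p R X) ⟶ Quot (CokernelRel p R' Y)}
    {a b : (T.obj R).functor.obj X ⟶ (T.obj R').functor.obj Y} (h : a = b)
    (hf : ∀ x, f (Quot.mk _ x) = Quot.mk _ (Sum.map a a x))
    (hg : ∀ x, g (Quot.mk _ x) = Quot.mk _ (Sum.map b b x)) : f = g := by
  subst h
  ext x
  induction x using Quot.ind with | _ x
  exact (hf x).trans (hg x).symm

variable (p)

/-- The pointwise cokernel pair of a morphism of signatures. -/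
@[reducible]
def cokernelPair : Signature.{u} where
  obj R :=
    { functor :=
        { obj := fun X => Quot (CokernelRel p R X)
          map := fun {X Y} g => cokernelMap p ((T.obj R).functor.map g)
            (exists_of_comp_eq p ((p.app R).nat.naturality g))
          map_id := fun X => by
            refine cokernelHom_eq ((T.obj R).functor.map_id X) ?_ ?_ <;> rintro (_ | _) <;> rfl
          map_comp := fun f g => by
            refine cokernelHom_eq ((T.obj R).functor.map_comp f g) ?_ ?_ <;>
              rintro (_ | _) <;> rfl }
      subst :=
        { app := fun X => cokernelMap p ((T.obj R).subst.app X)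
            (exists_of_comp_eq p ((p.app R).linear X))
          naturality := fun X Y g => by
            refine cokernelHom_eq ((T.obj R).subst.naturality g) ?_ ?_ <;>
              rintro (_ | _) <;> rfl }
      subst_subst := fun X => by
        refine cokernelHom_eq ((T.obj R).subst_subst X) ?_ ?_ <;> rintro (_ | _) <;> rfl
      map_unit_subst := fun X => by
        refine cokernelHom_eq ((T.obj R).map_unit_subst X) ?_ ?_ <;> rintro (_ | _) <;> rfl }
  map {R R'} f :=
    { nat :=
        { app := fun X => cokernelMap p ((T.map f).nat.app X)
            (exists_of_comp_eq p (p.naturality f X))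
          naturality := fun X Y g => by
            refine cokernelHom_eq ((T.map f).nat.naturality g) ?_ ?_ <;> rintro (_ | _) <;> rfl }
      linear := fun X => by
        refine cokernelHom_eq (R := R) (R' := R') (X := R.obj X) (Y := X)
          ((T.map f).linear X) ?_ ?_ <;> rintro (_ | _) <;> rfl }
  map_id R := by
    ext1
    funext X
    refine cokernelHom_eq (NatTrans.congr_app (T.map_id R) X) ?_ ?_ <;> rintro (_ | _) <;> rfl
  map_comp {R₁ R₂ R₃} f g X := by
    refine cokernelHom_eq (R := R₁) (R' := R₃) (X := X) (Y := X) (T.map_comp f g X) ?_ ?_ <;>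
      rintro (_ | _) <;> rfl

/-- The first coprojection into the cokernel pair. -/
def cokernelInl : T ⟶ cokernelPair p where
  app R :=
    { nat :=
        { app := fun X => TypeCat.ofHom fun x => Quot.mk (CokernelRel p R X) (Sum.inl x)
          naturality := fun _ _ _ => rfl }
      linear := fun _ => rfl }
  naturality _ _ := rfl

/-- The second coprojection into the cokernel pair. -/
def cokernelInr : T ⟶ cokernelPair p where
  app R :=
    { nat :=
        { app := fun X => TypeCat.ofHom fun x => Quot.mk (CokernelRel p R X) (Sum.inr x)
          naturality := fun _ _ _ => rfl }
      linear := fun _ => rfl }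
  naturality _ _ := rfl

/-- Epimorphisms of signatures are pointwise surjective. -/
theorem epi_app_of_epi [Epi p] (R : Monad (Type u)) (X : Type u) : Epi ((p.app R).nat.app X) := by
  have h : cokernelInl p = cokernelInr p := by
    rw [← cancel_epi p]
    refine Hom.ext (funext fun R => LMod.Hom.ext ?_)
    ext X x
    exact Quot.sound (CokernelRel.glue x)
  refine (epi_iff_surjective _).2 fun x => ?_
  have hx : (Quot.mk (CokernelRel p R X) (Sum.inl x)) = Quot.mk _ (Sum.inr x) :=
    congrArg (fun q : T ⟶ cokernelPair p => (q.app R).nat.app X x) h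
  -- This predicate holds on the whole left copy, but on the right copy only on the image of `p`.
  -- The gluing respects it, so equality of the two copies of `x` puts `x` in the image.
  let P : Quot (CokernelRel p R X) → Prop :=
    Quot.lift (Sum.elim (fun _ => True) fun x => ∃ y, (p.app R).nat.app X y = x) (by
      rintro _ _ ⟨y⟩
      exact (eq_true ⟨y, rfl⟩).symm)
  have hP : P (Quot.mk _ (Sum.inl x)) := trivial
  rw [hx] at hP
  exact hP

end CokernelPair

/-! ### Signatures preserving surjections: the elementary case. -/

/-- A signature preserves surjective monad morphisms if it sends them to surjective module
morphisms. -/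
def PreservesSurjective (S : Signature.{u}) : Prop :=
  ∀ ⦃R R' : Monad (Type u)⦄ (f : R ⟶ R'), (∀ X, Function.Surjective (f.app X)) →
    ∀ X, Function.Surjective ((S.map f).nat.app X)

theorem PreservesSurjective.theta : PreservesSurjective theta.{u} := fun _ _ _ hf => hf

theorem PreservesSurjective.deriv {S : Signature.{u}} (h : S.PreservesSurjective) :
    S.deriv.PreservesSurjective :=
  fun _ _ f hf X => h f hf (LMod.addPoint.obj X)

theorem PreservesSurjective.pi {ι : Type} {S : ι → Signature.{u}}
    (h : ∀ i, (S i).PreservesSurjective) : (pi S).PreservesSurjective := fun _ _ f hf X x => by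
  choose y hy using fun i => h i f hf X (x i)
  exact ⟨y, funext hy⟩

theorem PreservesSurjective.elementary (s : List ℕ) : (elementary.{u} s).PreservesSurjective := by
  refine PreservesSurjective.pi fun i => ?_
  induction s.get i with
  | zero => exact PreservesSurjective.theta
  | succ n ih =>
    rw [Function.iterate_succ_apply']
    exact ih.deriv

/-! ### Coproducts of signatures, and the algebraic case. -/

section Sigma

variable {I : Type u} (E : I → Signature.{u})

/-- The pointwise coproduct of a family of signatures. -/
@[reducible]
def sigma : Signature.{u} where
  obj R := LMod.sigma fun i => (E i).obj R
  map {R R'} f :=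
    { nat :=
        { app := fun X => TypeCat.ofHom (Sigma.map id fun i => ((E i).map f).nat.app X)
          naturality := fun X Y g => by
            refine ConcreteCategory.hom_ext _ _ fun ⟨i, x⟩ => ?_
            exact congrArg (Sigma.mk (β := fun i => ((E i).obj R').functor.obj _) i)
              (NatTrans.naturality_apply ((E i).map f).nat g x) }
      linear := fun X => by
        refine ConcreteCategory.hom_ext _ _ fun ⟨i, x⟩ => ?_
        exact congrArg (Sigma.mk (β := fun i => ((E i).obj R').functor.obj _) i)
          (ConcreteCategory.congr_hom (((E i).map f).linear X) x) }
  map_id R := by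
    ext1
    funext X
    refine ConcreteCategory.hom_ext _ _ fun ⟨i, x⟩ => ?_
    exact congrArg (Sigma.mk (β := fun i => ((E i).obj R).functor.obj _) i)
      (ConcreteCategory.congr_hom (NatTrans.congr_app ((E i).map_id R) X) x)
  map_comp {_ _ R} f g X := by
    refine ConcreteCategory.hom_ext _ _ fun ⟨i, x⟩ => ?_
    exact congrArg (Sigma.mk (β := fun i => ((E i).obj R).functor.obj _) i)
      (ConcreteCategory.congr_hom ((E i).map_comp f g X) x)

/-- The coprojections into the pointwise coproduct. -/
def sigmaMk (i : I) : E i ⟶ sigma E where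
  app _ :=
    { nat :=
        { app := fun _ => TypeCat.ofHom fun x => ⟨i, x⟩
          naturality := fun _ _ _ => rfl }
      linear := fun _ => rfl }
  naturality _ _ := rfl

variable {E}

/-- The morphism out of the pointwise coproduct induced by a family of morphisms. -/
def sigmaDesc {T : Signature.{u}} (q : ∀ i, E i ⟶ T) : sigma E ⟶ T where
  app R :=
    { nat :=
        { app := fun X => TypeCat.ofHom fun x => ((q x.1).app R).nat.app X x.2
          naturality := fun X Y g => by
            ext ⟨i, x⟩
            exact NatTrans.naturality_apply ((q i).app R).nat g x }
      linear := fun X => by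
        ext ⟨i, x⟩
        exact ConcreteCategory.congr_hom (((q i).app R).linear X) x }
  naturality f X := by
    ext ⟨i, x⟩
    exact ConcreteCategory.congr_hom ((q i).naturality f X) x

/-- The coprojections of a coproduct of signatures are jointly surjective. -/
theorem exists_app_eq_of_isColimit {T : Signature.{u}} {q : ∀ i, E i ⟶ T}
    (hq : Limits.IsColimit (Limits.Cofan.mk T q)) (R : Monad (Type u)) (X : Type u)
    (x : (T.obj R).functor.obj X) : ∃ i y, ((q i).app R).nat.app X y = x := by
  let r : T ⟶ sigma E := Limits.Cofan.IsColimit.desc hq (sigmaMk E)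
  -- `T` is a retract of the pointwise coproduct, which is enough: `r` sends an element to a summand
  -- and a preimage in it.
  have hr : r ≫ sigmaDesc q = 𝟙 T := by
    refine Limits.Cofan.IsColimit.hom_ext hq _ _ fun i => ?_
    have h : q i ≫ r = sigmaMk E i := Limits.Cofan.IsColimit.fac hq (sigmaMk E) i
    change q i ≫ r ≫ sigmaDesc q = q i ≫ 𝟙 T
    rw [reassoc_of% h, Category.comp_id]
    rfl
  let z : Σ i, ((E i).obj R).functor.obj X := (r.app R).nat.app X x
  exact ⟨z.1, z.2, congrArg (fun k : T ⟶ T => (k.app R).nat.app X x) hr⟩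

theorem PreservesSurjective.of_isColimit {T : Signature.{u}} {q : ∀ i, E i ⟶ T}
    (hq : Limits.IsColimit (Limits.Cofan.mk T q)) (h : ∀ i, (E i).PreservesSurjective) :
    T.PreservesSurjective := fun R R' f hf X x => by
  obtain ⟨i, y, rfl⟩ := exists_app_eq_of_isColimit hq R' X x
  obtain ⟨w, rfl⟩ := h i f hf X y
  exact ⟨((q i).app R).nat.app X w, (ConcreteCategory.congr_hom ((q i).naturality f X) w).symm⟩

end Sigma

/-- Algebraic signatures preserve surjective monad morphisms. -/
theorem IsAlgebraic.preservesSurjective {S : Signature.{u}} (h : S.IsAlgebraic) :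
    S.PreservesSurjective := by
  obtain ⟨I, s, q, ⟨hq⟩⟩ := h
  exact .of_isColimit hq fun i => .elementary (s i)

end Signature

/-! ### The reflection of a model along a presentation. -/

namespace Model

open Signature

section Reflection

variable {Υ S : Signature.{u}} (p : Υ ⟶ S) (A : Model Υ)

/-- The family of all model morphisms from `A` to models of `S`, on underlying monads. -/
@[reducible]
def reflectionFamily (i : Σ B : Model S, A ⟶ (pullback p).obj B) : A.monad ⟶ i.1.monad :=
  i.2.hom

/-- The monad of the reflection of `A`: the quotient of the monad of `A` identifying the elements
that no morphism to a model of `S` separates. -/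
@[reducible]
noncomputable def reflectionMonad : Monad (Type u) :=
  coimage (reflectionFamily p A)

/-- The projection onto the monad of the reflection. -/
@[reducible]
noncomputable def reflectionProj : A.monad ⟶ reflectionMonad p A :=
  quotientMonad.proj _ _ _ _ (map_coimageProj_mul _)

/-- The factorization of a model morphism through the monad of the reflection. -/
@[reducible]
noncomputable def reflectionDesc {B : Model S} (f : A ⟶ (pullback p).obj B) :
    reflectionMonad p A ⟶ B.monad :=
  quotientMonad.desc (hm := map_coimageProj_mul _) f.hom
    (coimageDesc (reflectionFamily p A) ⟨B, f⟩)
    (coimageProj_desc (reflectionFamily p A) ⟨B, f⟩)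

theorem reflectionProj_desc {B : Model S} (f : A ⟶ (pullback p).obj B) :
    reflectionProj p A ≫ reflectionDesc p A f = f.hom := rfl

theorem reflectionProj_surjective (X : Type u) :
    Function.Surjective ((reflectionProj p A).app X) :=
  Quotient.mk_surjective

/-- The module morphism `Υ(R) ⟶ S(R) ⟶ S(R̄)` to the reflection. -/
noncomputable def reflectionModuleProj :
    Υ.obj A.monad ⟶ (S.obj (reflectionMonad p A)).pullback (reflectionProj p A) :=
  p.app A.monad ≫ S.map (reflectionProj p A)

variable {p}

/-- Naturality of `p` reroutes the map through `Υ(R̄)`. Algebraicity of `Υ` makes the first factor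
surjective and epimorphy of `p` the second; nothing is asked of `S` on surjections. -/
theorem reflectionModuleProj_epi (hp : IsPresentation p) (X : Type u) :
    Epi ((reflectionModuleProj p A).nat.app X) := by
  have h1 : Epi ((Υ.map (reflectionProj p A)).nat.app X) :=
    (epi_iff_surjective _).2
      (hp.isAlgebraic.preservesSurjective _ (reflectionProj_surjective p A) X)
  have := hp.epi
  have h2 := epi_app_of_epi p (reflectionMonad p A) X
  have h : (reflectionModuleProj p A).nat.app X =
      (Υ.map (reflectionProj p A)).nat.app X ≫ (p.app (reflectionMonad p A)).nat.app X :=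
    (p.naturality (reflectionProj p A) X).symm
  rw [h]
  exact epi_comp _ _

/-- Functoriality of `S` merges the two maps into `S(f)`, and then naturality of `p` turns the claim
into the condition that `f` is a model morphism. -/
theorem reflectionModuleProj_desc {B : Model S} (f : A ⟶ (pullback p).obj B) (X : Type u) :
    (reflectionModuleProj p A).nat.app X ≫ (S.map (reflectionDesc p A f)).nat.app X ≫
      B.action.nat.app X = A.action.nat.app X ≫ f.hom.app X := by
  have h1 := S.map_comp (reflectionProj p A) (reflectionDesc p A f) X
  have h2 := f.comm X
  have h3 := p.naturality f.hom X
  rw [reflectionProj_desc] at h1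
  exact (congrArg (fun k => ((p.app A.monad).nat.app X ≫ k) ≫ B.action.nat.app X) h1.symm).trans
    ((h3.symm =≫ B.action.nat.app X).trans h2.symm)

/-- Elements of `Υ(R)` with the same image in `S(R̄)` act equally in `R̄`: by
`reflectionModuleProj_desc`, what any test morphism sees of their action depends only on that image.
-/
theorem exists_reflectionAction (hp : IsPresentation p) :
    ∃ a : S.obj (reflectionMonad p A) ⟶ LMod.taut (reflectionMonad p A),
      ∀ X, (reflectionModuleProj p A).nat.app X ≫ a.nat.app X =
        A.action.nat.app X ≫ (reflectionProj p A).app X := by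
  have (X : Type u) : IsSplitEpi ((reflectionProj p A).app X) :=
    (isSplitEpi_iff_surjective _).2 (reflectionProj_surjective p A X)
  refine LMod.exists_desc (reflectionProj p A) (reflectionModuleProj p A)
    (reflectionModuleProj_epi A hp) (A.action ≫ theta.map (reflectionProj p A))
    fun X x y h => Quotient.sound fun ⟨B, f⟩ => ?_
  have key (z) := ConcreteCategory.congr_hom (reflectionModuleProj_desc A f X) z
  refine (key x).symm.trans (Eq.trans ?_ (key y))
  exact congrArg ((S.map (reflectionDesc p A f)).nat.app X ≫ B.action.nat.app X) h

/-- The reflection of a model along a presentation. -/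
@[reducible]
noncomputable def reflection (hp : IsPresentation p) : Model S where
  monad := reflectionMonad p A
  action := (exists_reflectionAction A hp).choose

theorem reflectionModuleProj_action (hp : IsPresentation p) (X : Type u) :
    (reflectionModuleProj p A).nat.app X ≫ (reflection A hp).action.nat.app X =
      A.action.nat.app X ≫ (reflectionProj p A).app X :=
  (exists_reflectionAction A hp).choose_spec X

/-- The unit of the reflection. -/
@[reducible]
noncomputable def reflectionUnit (hp : IsPresentation p) :
    A ⟶ (pullback p).obj (reflection A hp) where
  hom := reflectionProj p A
  comm X := by
    have h := p.naturality (reflectionProj p A) X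
    change _ = (Υ.map (reflectionProj p A)).nat.app X ≫
      (p.app (reflectionMonad p A)).nat.app X ≫ (reflection A hp).action.nat.app X
    rw [reassoc_of% h]
    exact (reflectionModuleProj_action A hp X).symm.trans (Category.assoc _ _ _)

/-- The factorization of a model morphism through the reflection. -/
@[reducible]
noncomputable def reflectionLift (hp : IsPresentation p) {B : Model S}
    (f : A ⟶ (pullback p).obj B) : reflection A hp ⟶ B where
  hom := reflectionDesc p A f
  comm X := by
    -- Compatibility with the actions can be checked after this epimorphism, where both sides are
    -- the action of `A` followed by `f`.
    have := reflectionModuleProj_epi A hp X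
    have h := reflectionModuleProj_action A hp X
    rw [← cancel_epi ((reflectionModuleProj p A).nat.app X), reflectionModuleProj_desc,
      reassoc_of% h]
    rfl

/-- The unit of the reflection is initial among the morphisms from `A` to models of `S`. -/
noncomputable def reflectionIsInitial (hp : IsPresentation p) :
    Limits.IsInitial (StructuredArrow.mk (reflectionUnit A hp)) :=
  Limits.IsInitial.ofUniqueHom
    (fun B => StructuredArrow.homMk (reflectionLift A hp B.hom) (Hom.ext rfl))
    fun B m => by
      refine StructuredArrow.ext _ _ (Hom.ext (MonadHom.ext' _ _ (funext fun X => ?_)))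
      have hm := congrArg (fun k : A ⟶ _ => k.hom.app X) (StructuredArrow.w m)
      ext x
      -- Uniqueness: every element is a class, and the triangle with the unit prescribes `m` on
      -- classes.
      induction x using Quotient.inductionOn with | _ x
      exact ConcreteCategory.congr_hom hm x

end Reflection

end Model

end MonadSyntax

theorem theorem7p3 {Υ S : MonadSyntax.Signature.{u}} (p : Υ ⟶ S)
    (hp : MonadSyntax.Signature.IsPresentation p) :
    (MonadSyntax.Model.pullback p).IsRightAdjoint := by
  have (A : MonadSyntax.Model Υ) :
      Limits.HasInitial (StructuredArrow A (MonadSyntax.Model.pullback p)) :=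
    (MonadSyntax.Model.reflectionIsInitial A hp).hasInitial
  exact isRightAdjointOfStructuredArrowInitials _
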